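/- Let $n \ge 1$ and let $\lambda = (\lambda_1 \ge \dots \ge \lambda_n \ge 0)$ be a partition with at most $n$ parts, identified with its shape, whose column lengths are $\zeta_1 \ge \dots \ge \zeta_{\lambda_1}$. Let $R_\lambda = \{q_1 < \dots < q_r\}$ be the set of its column lengths less than $n$, and put $q_0 := 0$, $q_{r+1} := n$. A $\lambda$-permutation is a permutation $\pi = (\pi_1,\dots,\pi_n)$ of $\{1,\dots,n\}$ such that $\pi_{q_{h-1}+1} < \dots < \pi_{q_h}$ for $1 \le h \le r+1$. It is $\lambda$-312-avoiding if there are no $h \in \{1,\dots,r-1\}$ and indices $1 \le a \le q_h < b \le q_{h+1} < c \le n$ with $\pi_b < \pi_c < \pi_a$. Let $\mathcal T_\lambda$ be the set of semistandard tableaux of shape $\lambda$ with values in $\{1,\dots,n\}$ (strictly increasing down columns, weakly increasing along rows), partially ordered by entrywise comparison and viewed as a subset of $\mathbb Z^{|\lambda|}$. The key $Y_\lambda(\pi) \in \mathcal T_\lambda$ is the tableau whose set of values in a column of length $q$ is $\{\pi_1,\dots,\pi_q\}$. For $T \in \mathcal T_\lambda$ the scanning tableau $S(T)$ is the filling of $\lambda$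 obtained as follows. The earliest weakly increasing subsequence of $x_1, x_2, \dots$ is $x_{i_1}, x_{i_2}, \dots$, where $i_1 = 1$ and, for $u > 1$, $i_u > i_{u-1}$ is the smallest such index with $x_{i_u} \ge x_{i_{u-1}}$. To find the $j$-th column of $S(T)$, ignore the first $j-1$ columns of $T$ and start with no box marked. Then repeat the following step $\zeta_j$ times, to fill the column from its lowest box to its highest: form the sequence of the lowest unmarked values of the columns that still have an unmarked box, from left to right; find its earliest weakly increasing subsequence; place the final value of this subsequence in the next box of the $j$-th column of $S(T)$; and mark the boxes that contributed to the subsequence. Define the set of Demazure tableaux $$\mathcal D_\lambda(\pi) := \{\, T \in \mathcal T_\lambda : S(T) \le Y_\lambda(\pi) \text{ entrywise} \,\}.$$ **Theorem.** If $\pi$ is a $\lambda$-312-avoiding $\lambda$-permutation, then $\mathcal D_\lambda(\pi)$ is the principal ideal $[Y_\lambda(\pi)] = \{T \in \mathcal T_\lambda : T \le Y_\lambda(\pi)\}$ of $\mathcal T_\lambda$. Moreover $\mathcal D_\lambda(\pi)$ is a convex polytope in $\mathbb Z^{|\lambda|}$, that is, it is the set of all integer points that satisfy some finite system of linear inequalities.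 -/

import Mathlib

namespace DemazureTableaux

/-! ### Dividers, `R`-permutations and `R`-312-avoidance

Positions `1, …, n` and values `1, …, n` of a permutation are both represented by `Fin n`: the
position `i : Fin n` stands for `i + 1`, and `π_{i+1} = π i + 1`. -/

/-- For `R = {q_1 < ⋯ < q_r} ⊆ [n-1]`, the divider `q_h`, where `q_0 = 0` and `q_{r+1} = n`. -/
def divider (n : ℕ) (R : Finset ℕ) (h : ℕ) : ℕ :=
  (0 :: R.sort (· ≤ ·)).getD h n

/-- `π` is an `R`-permutation: its entries increase on every carrel `(q_h, q_{h+1}]`,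
`0 ≤ h ≤ r`. The position `i + 1` is in the carrel if and only if `q_h ≤ i < q_{h+1}`. -/
def IsRPermutation {n : ℕ} (R : Finset ℕ) (π : Equiv.Perm (Fin n)) : Prop :=
  ∀ h ≤ R.card, ∀ a b : Fin n,
    divider n R h ≤ a → a < b → (b : ℕ) < divider n R (h + 1) → π a < π b

/-- `π` is `R`-312-containing: for some `h ∈ [r-1]` there are positions
`a ≤ q_h < b ≤ q_{h+1} < c` (counted from `1`) such that `π_a > π_b < π_c` and `π_a > π_c`. -/
def IsR312Containing {n : ℕ} (R : Finset ℕ) (π : Equiv.Perm (Fin n)) : Prop :=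
  ∃ h : ℕ, 1 ≤ h ∧ h < R.card ∧ ∃ a b c : Fin n,
    (a : ℕ) < divider n R h ∧
    divider n R h ≤ b ∧ (b : ℕ) < divider n R (h + 1) ∧
    divider n R (h + 1) ≤ c ∧
    π b < π a ∧ π b < π c ∧ π c < π a

/-- `π` is `R`-312-avoiding. -/
def IsR312Avoiding {n : ℕ} (R : Finset ℕ) (π : Equiv.Perm (Fin n)) : Prop :=
  ¬ IsR312Containing R π

/-! ### Shapes and tableaux

A partition `λ_1 ≥ ⋯ ≥ λ_n ≥ 0` is represented by its shape, a Young diagram `μ` with at most `n`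
rows (`μ.colLen 0 ≤ n`). Rows and columns of the diagram are counted from `0`, so that
`μ.rowLen i = λ_{i+1}` and `μ.colLen j = ζ_{j+1}`; the box in row `i` and column `j` is `(i, j)`. -/

/-- The set `R_λ` of column lengths of the shape that are less than `n`. -/
def columnLengths (n : ℕ) (μ : YoungDiagram) : Finset ℕ :=
  ((Finset.range (μ.rowLen 0)).image μ.colLen).filter (· < n)

/-- The set `𝒯_λ` of semistandard tableaux of shape `μ` with values in `[n] = {1, …, n}`. -/
def Tableau (n : ℕ) (μ : YoungDiagram) : Type :=
  {T : SemistandardYoungTableau μ // ∀ i j : ℕ, (i, j) ∈ μ → 1 ≤ T i j ∧ T i j ≤ n}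

/-- Entrywise comparison of tableaux (the entries outside the shape are all `0`). -/
instance (n : ℕ) (μ : YoungDiagram) : PartialOrder (Tableau n μ) :=
  PartialOrder.lift (fun T => (fun i j => T.1 i j : ℕ → ℕ → ℕ))
    fun _ _ h => Subtype.ext (SemistandardYoungTableau.ext fun i j => congrFun (congrFun h i) j)

/-- A tableau as a point of `ℤ^{|λ|}`: its coordinates are its values at the boxes. -/
def Tableau.toPoint {n : ℕ} {μ : YoungDiagram} (T : Tableau n μ) : μ.cells → ℤ :=
  fun c => (T.1 c.1.1 c.1.2 : ℤ)

/-! ### The key of a permutation -/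

/-- The set `{π_1, …, π_q} ⊆ [n]`. -/
def firstValues {n : ℕ} (π : Equiv.Perm (Fin n)) (q : ℕ) : Finset ℕ :=
  (Finset.univ.filter fun i : Fin n => (i : ℕ) < q).image fun i => (π i : ℕ) + 1

theorem card_firstValues {n : ℕ} (π : Equiv.Perm (Fin n)) {q : ℕ} (hq : q ≤ n) :
    (firstValues π q).card = q := by
  unfold firstValues
  rw [Finset.card_image_of_injective]
  · simp [Fin.card_filter_val_lt, hq]
  · intro a b h
    exact π.injective (Fin.ext (by simpa using h))

theorem firstValues_mono {n : ℕ} (π : Equiv.Perm (Fin n)) {p q : ℕ} (h : p ≤ q) :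
    firstValues π p ⊆ firstValues π q := by
  unfold firstValues
  refine Finset.image_subset_image fun i hi => ?_
  simp only [Finset.mem_filter, Finset.mem_univ, true_and] at hi ⊢
  omega

theorem mem_firstValues_bounds {n : ℕ} (π : Equiv.Perm (Fin n)) {q v : ℕ}
    (h : v ∈ firstValues π q) : 1 ≤ v ∧ v ≤ n := by
  unfold firstValues at h
  simp only [Finset.mem_image, Finset.mem_filter, Finset.mem_univ, true_and] at h
  obtain ⟨i, -, rfl⟩ := h
  have := (π i).isLt
  omega

/-- The entry in row `i` (from `0`) of the column `Y(Q)` whose set of values is `Q`: the element of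
`Q` with exactly `i` smaller elements in `Q` (and `0` if there is none). -/
noncomputable def columnEntry (Q : Finset ℕ) (i : ℕ) : ℕ :=
  Nat.nth (· ∈ Q) i

theorem lt_card_aux {Q : Finset ℕ} {i : ℕ} (hi : i < Q.card) :
    ∀ hf : (Set.ofPred (· ∈ Q)).Finite, i < hf.toFinset.card := by
  intro hf
  have : hf.toFinset = Q := by ext; simp
  rwa [this]

theorem columnEntry_mem {Q : Finset ℕ} {i : ℕ} (hi : i < Q.card) : columnEntry Q i ∈ Q :=
  Nat.nth_mem (p := (· ∈ Q)) i (lt_card_aux hi)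

theorem columnEntry_lt {Q : Finset ℕ} {i k : ℕ} (hik : i < k) (hk : k < Q.card) :
    columnEntry Q i < columnEntry Q k :=
  Nat.nth_lt_nth' (p := (· ∈ Q)) hik (lt_card_aux hk)

theorem columnEntry_anti {P Q : Finset ℕ} (h : P ⊆ Q) {i : ℕ} (hi : i < P.card) :
    columnEntry Q i ≤ columnEntry P i := by
  refine Nat.lt_succ_iff.mp (Nat.nth_lt_of_lt_count ?_)
  have h1 : Nat.count (· ∈ P) (columnEntry P i + 1) = i + 1 :=
    Nat.count_nth_succ (p := (· ∈ P)) (lt_card_aux hi)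
  have h2 : Nat.count (· ∈ P) (columnEntry P i + 1) ≤ Nat.count (· ∈ Q) (columnEntry P i + 1) :=
    Nat.count_mono_left fun k _ hk => h hk
  have h3 : i < Nat.count (· ∈ Q) (columnEntry P i + 1) := by omega
  exact h3

/-- The key `Y_λ(π)`: the set of values of a column of length `q` is `{π_1, …, π_q}`. Thus the
columns of length `n` are inert, and the columns of length `q_h` are copies of `Y(B_h)`, where
`B_h = {π_1, …, π_{q_h}}`. -/
noncomputable def key {n : ℕ} {μ : YoungDiagram} (hμ : μ.colLen 0 ≤ n) (π : Equiv.Perm (Fin n)) :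
    Tableau n μ :=
  have hcard : ∀ j, (firstValues π (μ.colLen j)).card = μ.colLen j := fun j =>
    card_firstValues π ((μ.colLen_anti 0 j (Nat.zero_le j)).trans hμ)
  ⟨{ entry := fun i j => if (i, j) ∈ μ then columnEntry (firstValues π (μ.colLen j)) i else 0
     row_weak' := by
      intro i j1 j2 hj hc
      have hc1 : (i, j1) ∈ μ := μ.up_left_mem le_rfl hj.le hc
      simp only [hc, hc1, if_true]
      refine columnEntry_anti (firstValues_mono π (μ.colLen_anti j1 j2 hj.le)) ?_
      rw [hcard]
      exact YoungDiagram.mem_iff_lt_colLen.mp hc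
     col_strict' := by
      intro i1 i2 j hi hc
      have hc1 : (i1, j) ∈ μ := μ.up_left_mem hi.le le_rfl hc
      simp only [hc, hc1, if_true]
      refine columnEntry_lt hi ?_
      rw [hcard]
      exact YoungDiagram.mem_iff_lt_colLen.mp hc
     zeros' := by
      intro i j hc
      simp only [hc, if_false] },
   by
    intro i j hc
    change 1 ≤ (if (i, j) ∈ μ then _ else 0) ∧ (if (i, j) ∈ μ then _ else 0) ≤ n
    simp only [hc, if_true]
    refine mem_firstValues_bounds π (columnEntry_mem ?_)
    rw [hcard]
    exact YoungDiagram.mem_iff_lt_colLen.mp hc⟩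

/-! ### The scanning tableau and Demazure tableaux

Here a filling is the list of its columns from left to right, and a column is the list of its
unmarked values from bottom to top, so that its head is its current bottom value. -/

/-- `scan x cs` continues an earliest weakly increasing subsequence of bottom values, whose most
recent value is `x`, through the columns `cs`: from left to right, each bottom value that is at
least the most recent value is appended and its box is marked (removed). Columns without unmarked
boxes are passed over. The result is the final value of the subsequence and the columns that remain
when the marked boxes are removed. -/
def scan : ℕ → List (List ℕ) → ℕ × List (List ℕ)
  | x, [] => (x, [])
  | x, [] :: cs => ((scan x cs).1, [] :: (scan x cs).2)
  | x, (y :: c) :: cs =>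
    if x ≤ y then ((scan y cs).1, c :: (scan y cs).2)
    else ((scan x cs).1, (y :: c) :: (scan x cs).2)

/-- `scanColumn c cs` lists, from bottom to top, the first column of the scanning tableau of the
filling with first column `c` and remaining columns `cs`: the boxes of `c` are processed from bottom
to top, and each scanning path is found after the boxes of the earlier ones have been removed. -/
def scanColumn : List ℕ → List (List ℕ) → List ℕ
  | [], _ => []
  | x :: c, cs => (scan x cs).1 :: scanColumn c (scan x cs).2

/-- The columns of the scanning tableau: for each further column, the columns to its left are
dropped and all earlier marks are removed. -/
def scanColumns : List (List ℕ) → List (List ℕ)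
  | [] => []
  | c :: cs => scanColumn c cs :: scanColumns cs

/-- The columns of a tableau from left to right, each listed from bottom to top. -/
def Tableau.columns {n : ℕ} {μ : YoungDiagram} (T : Tableau n μ) : List (List ℕ) :=
  (List.range (μ.rowLen 0)).map fun j =>
    ((List.range (μ.colLen j)).map fun i => T.1 i j).reverse

/-- The scanning tableau `S(T)`, as a filling: its entry in row `i` and column `j`. -/
def Tableau.scanning {n : ℕ} {μ : YoungDiagram} (T : Tableau n μ) (i j : ℕ) : ℕ :=
  (((scanColumns T.columns).getD j []).reverse).getD i 0

/-- The set `𝒟_λ(π)` of Demazure tableaux: the tableaux `T` such that `S(T) ≤ Y_λ(π)` entrywise. -/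
def demazure {n : ℕ} {μ : YoungDiagram} (hμ : μ.colLen 0 ≤ n) (π : Equiv.Perm (Fin n)) :
    Set (Tableau n μ) :=
  {T | ∀ i j : ℕ, (i, j) ∈ μ → T.scanning i j ≤ (key hμ π).1 i j}

/-! ### Convex polytopes in `ℤ^N` -/

/-- A set of integer points is a convex polytope if it is the set of all integer points that satisfy
some finite system of linear inequalities. -/
def IsConvexPolytope {ι : Type*} [Fintype ι] (D : Set (ι → ℤ)) : Prop :=
  ∃ (m : ℕ) (A : Fin m → ι → ℝ) (b : Fin m → ℝ),
    D = {x : ι → ℤ | ∀ k, ∑ i, A k i * (x i : ℝ) ≤ b k}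

end DemazureTableaux

namespace DemazureTableaux

/-! ### Scanning a column at a time -/

/-! A scanning path is weakly increasing and starts in the box it fills, so `T ≤ S(T)` and Demazure
tableaux lie in the ideal (`Tableau.le_scanning`). The content is the converse: `T ≤ Y` forces `S(T)
≤ Y`. All paths from a column can be advanced together across one column at a time
(`scanColumn_cons_right`), so it suffices that each crossing preserves the bound by the value set
`P` of the starting key column (`Dominated.pass`).

Let `N_v` count the values greater than `v`. If `c` crosses `d`, the new `N_v` is at most `N_w(c) +
N_v(d) - N_w(d)` for some `w ≥ v` (`exists_countGT_pass_le`). Avoidance of 312 makes the value sets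
`Q ⊆ P` of two key columns a gapless pair: an integer outside `P` and below some element of `Q` is
below all of `P \ Q` (`gapless_firstValues`). This bounds the expression by `N_v(P)`
(`Dominated.countGT_add_le`).

The ideal is then cut out by the semistandard inequalities and the bounds from `Y`. -/

/-- The current values of the scanning paths that start with the values `c`, after they have
crossed a column `d`. -/
def pass : List ℕ → List ℕ → List ℕ
  | [], _ => []
  | x :: c, [] => x :: c
  | x :: c, y :: d => if x ≤ y then y :: pass c d else x :: pass c (y :: d)

theorem pass_nil_right (c : List ℕ) : pass c [] = c := by
  cases c <;> simp [pass]

theorem scanColumn_nil_right (c : List ℕ) : scanColumn c [] = c := by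
  induction c with
  | nil => rfl
  | cons x c ih => simp [scanColumn, scan, ih]

/-- Whether a path takes a box of `d` depends only on its current value and on what earlier paths
took from `d`, never on the columns beyond; hence the order of paths and columns can be exchanged.
-/
theorem scanColumn_cons_right (c d : List ℕ) (ds : List (List ℕ)) :
    scanColumn c (d :: ds) = scanColumn (pass c d) ds := by
  induction c generalizing d ds with
  | nil => simp [scanColumn, pass]
  | cons x c ih =>
    cases d with
    | nil => simp [scanColumn, scan, ih, pass, pass_nil_right]
    | cons y d =>
      by_cases h : x ≤ y <;> simp [scanColumn, scan, ih, pass, h]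

theorem length_pass (c d : List ℕ) : (pass c d).length = c.length := by
  induction c generalizing d with
  | nil => simp [pass]
  | cons x c ih =>
    cases d with
    | nil => simp [pass]
    | cons y d => by_cases h : x ≤ y <;> simp [pass, ih, h]

theorem mem_or_mem_of_mem_pass {c d : List ℕ} {z : ℕ} (h : z ∈ pass c d) : z ∈ c ∨ z ∈ d := by
  induction c generalizing d with
  | nil => simp [pass] at h
  | cons x c ih =>
    cases d with
    | nil => simpa [pass] using h
    | cons y d =>
      by_cases hxy : x ≤ y <;> simp only [pass, hxy, if_true, if_false, List.mem_cons] at h ⊢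
      · rcases h with h | h
        · tauto
        · have := ih h; tauto
      · rcases h with h | h
        · tauto
        · have := ih h; simp only [List.mem_cons] at this; tauto

theorem pairwise_pass {c d : List ℕ} (hc : c.Pairwise (· > ·)) (hd : d.Pairwise (· > ·)) :
    (pass c d).Pairwise (· > ·) := by
  induction c generalizing d with
  | nil => simp [pass]
  | cons x c ih =>
    cases d with
    | nil => simpa [pass] using hc
    | cons y d =>
      have hc' := List.pairwise_cons.mp hc
      have hd' := List.pairwise_cons.mp hd
      by_cases hxy : x ≤ y <;> simp only [pass, hxy, if_true, if_false, List.pairwise_cons]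
      · refine ⟨fun z hz => ?_, ih hc'.2 hd'.2⟩
        rcases mem_or_mem_of_mem_pass hz with hz | hz
        · exact (hc'.1 z hz).trans_le hxy
        · exact hd'.1 z hz
      · refine ⟨fun z hz => ?_, ih hc'.2 hd⟩
        rcases mem_or_mem_of_mem_pass hz with hz | hz
        · exact hc'.1 z hz
        · rcases List.mem_cons.mp hz with rfl | hz
          · omega
          · have := hd'.1 z hz
            omega

/-! ### Counting large values -/

/-- The number of values of a column that are greater than `v`. -/
def countGT (v : ℕ) (l : List ℕ) : ℕ :=
  l.countP (v < ·)

theorem countGT_cons (v x : ℕ) (l : List ℕ) :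
    countGT v (x :: l) = countGT v l + if v < x then 1 else 0 := by
  simp [countGT, List.countP_cons]

theorem countGT_eq_zero {v : ℕ} {l : List ℕ} (h : ∀ x ∈ l, x ≤ v) : countGT v l = 0 := by
  simpa [countGT, List.countP_eq_zero] using h

/-- Induction along the greedy matching: the level `w` of the tail is kept unless the heads break
the inequality. In that case no value of the tail of `c` exceeds `w`, and a new level is chosen at
which the remaining values of `d` contribute nothing. -/
theorem exists_countGT_pass_le {c d : List ℕ} (hc : c.Pairwise (· > ·))
    (hd : d.Pairwise (· > ·)) (v : ℕ) :
    ∃ w, v ≤ w ∧ countGT v (pass c d) + countGT w d ≤ countGT w c + countGT v d := by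
  induction c generalizing d with
  | nil => exact ⟨v, le_rfl, by simp [pass, countGT]⟩
  | cons x c ih =>
    cases d with
    | nil => exact ⟨v, le_rfl, by simp [pass, countGT]⟩
    | cons y d =>
      have hc' := List.pairwise_cons.mp hc
      have hd' := List.pairwise_cons.mp hd
      by_cases hxy : x ≤ y <;> simp only [pass, hxy, if_true, if_false]
      · obtain ⟨w, hvw, hw⟩ := ih hc'.2 hd'.2
        -- The only case in which the heads add more on the left than on the right.
        by_cases hbad : x ≤ w ∧ w < y
        · have h0 : countGT w c = 0 :=
            countGT_eq_zero fun z hz => ((hc'.1 z hz).trans_le hbad.1).le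
          have h1 : countGT y d = 0 := countGT_eq_zero fun z hz => (hd'.1 z hz).le
          refine ⟨y, by omega, ?_⟩
          simp only [countGT_cons, h1]
          split_ifs <;> omega
        · refine ⟨w, hvw, ?_⟩
          simp only [countGT_cons]
          split_ifs <;> omega
      · obtain ⟨w, hvw, hw⟩ := ih hc'.2 hd
        by_cases hbad : v < x ∧ x ≤ w
        · have h0 : countGT w c = 0 :=
            countGT_eq_zero fun z hz => ((hc'.1 z hz).trans_le hbad.2).le
          have h1 : countGT (x - 1) (y :: d) = 0 := countGT_eq_zero fun z hz => by
            rcases List.mem_cons.mp hz with rfl | hz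
            · omega
            · have := hd'.1 z hz
              omega
          -- At level `x - 1` the unmoved head `x` counts on both sides, and no value of the crossed
          -- column is left.
          refine ⟨x - 1, by omega, ?_⟩
          rw [h1, countGT_cons v x, countGT_cons (x - 1) x]
          split_ifs <;> omega
        · refine ⟨w, hvw, ?_⟩
          rw [countGT_cons v x, countGT_cons w x]
          split_ifs <;> omega

/-- The top-aligned columns `c` and `d` have weakly increasing rows, in terms of counts. -/
def RowLE (c d : List ℕ) : Prop :=
  ∀ v, countGT v c + d.length ≤ countGT v d + c.length

theorem RowLE.trans {c d e : List ℕ} (h : RowLE c d) (h' : RowLE d e) : RowLE c e := fun v => by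
  have := h v
  have := h' v
  omega

/-- At the level `w` of the crossing estimate, `RowLE c d` replaces the difference of counts by the
difference of lengths. -/
theorem RowLE.pass {c d : List ℕ} (hc : c.Pairwise (· > ·)) (hd : d.Pairwise (· > ·))
    (h : RowLE c d) : RowLE (pass c d) d := fun v => by
  obtain ⟨w, -, hw⟩ := exists_countGT_pass_le hc hd v
  have := h w
  rw [length_pass]
  omega

/-- The column `c` is entrywise at most the column with set of values `P`, in terms of counts. -/
def Dominated (c : List ℕ) (P : Finset ℕ) : Prop :=
  ∀ v, countGT v c ≤ (P.filter (v < ·)).card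

/-- The sets of values `Q ⊆ P` of two columns of a key form a gapless pair. -/
def Gapless (P Q : Finset ℕ) : Prop :=
  Q ⊆ P ∧ ∀ a b z, a ∈ Q → b ∈ P → b ∉ Q → b < z → z < a → z ∈ P

theorem countGT_le_add {d : List ℕ} (hd : d.Pairwise (· > ·)) (v w : ℕ) :
    countGT v d ≤ countGT w d + (w - v) := by
  have hnd : d.Nodup := hd.imp fun h => (ne_of_gt h)
  have key : ∀ u, countGT u d = (d.toFinset.filter (u < ·)).card := fun u => by
    rw [countGT, List.countP_eq_length_filter, ← List.toFinset_card_of_nodup (hnd.filter _),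
      List.toFinset_filter]
    simp
  rw [key, key, ← Nat.card_Ioc v w]
  refine (Finset.card_le_card ?_).trans (Finset.card_union_le _ _)
  intro z hz
  simp only [Finset.mem_filter, Finset.mem_union, Finset.mem_Ioc] at hz ⊢
  by_cases w < z <;> grind

/-- If `(v, w]` lies in `P`, strictness of `d` suffices. Otherwise some `z` in it is missing from
`P`: either gaplessness puts `P \ Q` above `z`, or `d` has no values from `z` on and `w` can be
lowered to `z - 1`. -/
theorem Dominated.countGT_add_le {c d : List ℕ} {P Q : Finset ℕ} (hd : d.Pairwise (· > ·))
    (hcP : Dominated c P) (hdQ : Dominated d Q) (hlc : c.length = P.card)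
    (hld : d.length = Q.card) (hrow : RowLE c d) (hgap : Gapless P Q) {v w : ℕ} (hvw : v ≤ w) :
    countGT w c + countGT v d ≤ (P.filter (v < ·)).card + countGT w d := by
  induction w using Nat.strong_induction_on with
  | _ w ih =>
    by_cases hall : Finset.Ioc v w ⊆ P
    · have h1 : (P.filter (w < ·)).card + (w - v) ≤ (P.filter (v < ·)).card := by
        rw [← Nat.card_Ioc v w, ← Finset.card_union_of_disjoint]
        · refine Finset.card_le_card fun z hz => ?_
          simp only [Finset.mem_filter, Finset.mem_union] at hz ⊢
          rcases hz with hz | hz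
          · exact ⟨hz.1, by omega⟩
          · exact ⟨hall hz, (Finset.mem_Ioc.mp hz).1⟩
        · rw [Finset.disjoint_left]
          intro z hz hz'
          simp only [Finset.mem_filter, Finset.mem_Ioc] at hz hz'
          omega
      have := countGT_le_add hd v w
      have := hcP w
      omega
    · obtain ⟨z, hz, hzP⟩ := Finset.not_subset.mp hall
      rw [Finset.mem_Ioc] at hz
      by_cases hQ : ∃ a ∈ Q, z < a
      · obtain ⟨a, haQ, hza⟩ := hQ
        -- So `P` has at least `|P| - |Q|` more elements above `v` than `Q`, which is the surplus
        -- that `hrow` allows at `w`.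
        have hsub : P \ Q ⊆ (P.filter (v < ·)) \ (Q.filter (v < ·)) := fun b hb => by
          rw [Finset.mem_sdiff] at hb
          have hbz : ¬ b < z := fun hbz => hzP (hgap.2 a b z haQ hb.1 hb.2 hbz hza)
          simp only [Finset.mem_sdiff, Finset.mem_filter]
          exact ⟨⟨hb.1, by omega⟩, fun h => hb.2 h.1⟩
        have h1 := Finset.card_le_card hsub
        rw [Finset.card_sdiff_of_subset hgap.1,
          Finset.card_sdiff_of_subset (Finset.filter_subset_filter _ hgap.1)] at h1
        have h2 := Finset.card_le_card (Finset.filter_subset_filter (v < ·) hgap.1)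
        have := hdQ v
        have := hrow w
        omega
      · have h0 : countGT (z - 1) d = 0 := by
          refine Nat.le_zero.mp ((hdQ _).trans (Nat.le_zero.mpr ?_))
          rw [Finset.card_eq_zero, Finset.filter_eq_empty_iff]
          intro a ha hza
          exact hQ ⟨a, ha, lt_of_le_of_ne (by omega) fun h => hzP (h ▸ hgap.1 ha)⟩
        have := ih (z - 1) (by omega) (by omega)
        have : countGT w c ≤ countGT (z - 1) c :=
          List.countP_mono_left fun x _ hx => by
            simp only [decide_eq_true_eq] at hx ⊢
            omega
        omega

theorem Dominated.pass {c d : List ℕ} {P Q : Finset ℕ} (hc : c.Pairwise (· > ·))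
    (hd : d.Pairwise (· > ·)) (hcP : Dominated c P) (hdQ : Dominated d Q)
    (hlc : c.length = P.card) (hld : d.length = Q.card) (hrow : RowLE c d)
    (hgap : Gapless P Q) : Dominated (pass c d) P := fun v => by
  obtain ⟨w, hvw, hw⟩ := exists_countGT_pass_le hc hd v
  have := hcP.countGT_add_le hd hdQ hlc hld hrow hgap hvw
  omega

theorem length_scanColumn (c : List ℕ) (cs : List (List ℕ)) :
    (scanColumn c cs).length = c.length := by
  induction c generalizing cs with
  | nil => rfl
  | cons x c ih => simp [scanColumn, ih]

/-- `P` stays fixed while the current values cross all columns; row comparison with later columns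
survives by transitivity through the column just crossed. -/
theorem scanColumn_dominated {c : List ℕ} {cs : List (List ℕ)} {P : Finset ℕ}
    (hc : c.Pairwise (· > ·)) (hcP : Dominated c P) (hlc : c.length = P.card)
    (hcs : ∀ d ∈ cs, d.Pairwise (· > ·) ∧
      ∃ Q : Finset ℕ, Dominated d Q ∧ d.length = Q.card ∧ Gapless P Q)
    (hrow : (c :: cs).Pairwise RowLE) :
    (scanColumn c cs).Pairwise (· > ·) ∧ Dominated (scanColumn c cs) P := by
  induction cs generalizing c with
  | nil => rw [scanColumn_nil_right]; exact ⟨hc, hcP⟩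
  | cons d ds ih =>
    obtain ⟨hd, Q, hdQ, hld, hgap⟩ := hcs d List.mem_cons_self
    obtain ⟨hcrow, hdsrow⟩ := List.pairwise_cons.mp hrow
    have hcd := hcrow d List.mem_cons_self
    rw [scanColumn_cons_right]
    refine ih (pairwise_pass hc hd) (hcP.pass hc hd hdQ hlc hld hcd hgap)
      ((length_pass c d).trans hlc) (fun e he => hcs e (List.mem_cons_of_mem _ he)) ?_
    obtain ⟨hdrow, hds⟩ := List.pairwise_cons.mp hdsrow
    exact List.pairwise_cons.mpr ⟨fun e he => (hcd.pass hc hd).trans (hdrow e he), hds⟩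

theorem le_scan (x : ℕ) (cs : List (List ℕ)) : x ≤ (scan x cs).1 := by
  induction cs generalizing x with
  | nil => simp [scan]
  | cons d ds ih =>
    cases d with
    | nil => simpa [scan] using ih x
    | cons y d =>
      by_cases h : x ≤ y <;> simp only [scan, h, if_true, if_false]
      · exact h.trans (ih y)
      · exact ih x

theorem forall₂_le_scanColumn (c : List ℕ) (cs : List (List ℕ)) :
    List.Forall₂ (· ≤ ·) c (scanColumn c cs) := by
  induction c generalizing cs with
  | nil => exact .nil
  | cons x c ih => exact .cons (le_scan x cs) (ih _)

/-! ### Columns and entries -/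

theorem card_filter_lt_columnEntry {P : Finset ℕ} {i : ℕ} (hi : i < P.card) :
    (P.filter (columnEntry P i < ·)).card + (i + 1) = P.card := by
  have h1 : Nat.count (· ∈ P) (columnEntry P i + 1) = i + 1 :=
    Nat.count_nth_succ (p := (· ∈ P)) (lt_card_aux hi)
  rw [Nat.count_eq_card_filter_range] at h1
  have h2 : (Finset.range (columnEntry P i + 1)).filter (· ∈ P) =
      P.filter (¬ columnEntry P i < ·) := by
    ext z
    simp only [Finset.mem_filter, Finset.mem_range]
    rw [Nat.lt_succ_iff, not_lt, and_comm]
  rw [h2] at h1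
  have := P.card_filter_add_card_filter_not (columnEntry P i < ·)
  omega

/-- If row `i` violated the bound, all `|P| - i` entries from there down would exceed a value that
only `|P| - i - 1` elements of `P` exceed. -/
theorem reverse_getD_le_columnEntry {l : List ℕ} {P : Finset ℕ} (hl : l.Pairwise (· > ·))
    (hlen : l.length = P.card) (hdom : Dominated l P) {i : ℕ} (hi : i < P.card) :
    l.reverse.getD i 0 ≤ columnEntry P i := by
  by_contra! hlt
  have hs : l.reverse.Pairwise (· < ·) := List.pairwise_reverse.mpr hl
  have hi' : i < l.reverse.length := by simpa [hlen] using hi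
  rw [List.getD_eq_getElem _ _ hi'] at hlt
  have h1 : countGT (columnEntry P i) (l.reverse.drop i) = (l.reverse.drop i).length := by
    rw [countGT, List.countP_eq_length]
    intro z hz
    obtain ⟨k, hk, rfl⟩ := List.getElem_of_mem hz
    simp only [List.getElem_drop, decide_eq_true_eq]
    rcases Nat.eq_zero_or_pos k with rfl | hk0
    · simpa using hlt
    · exact hlt.trans (List.pairwise_iff_getElem.mp hs _ _ _ _ (by omega))
  have h2 : countGT (columnEntry P i) (l.reverse.drop i) ≤ countGT (columnEntry P i) l := by
    have := (List.drop_sublist i l.reverse).countP_le (p := (columnEntry P i < ·))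
    rwa [List.countP_reverse] at this
  have h3 := hdom (columnEntry P i)
  have h4 := card_filter_lt_columnEntry hi
  simp only [List.length_drop, List.length_reverse] at h1
  omega

/-- The column with entries `f 0, …, f (p - 1)` from top to bottom, listed from bottom to top. -/
def columnList (f : ℕ → ℕ) (p : ℕ) : List ℕ :=
  ((List.range p).map f).reverse

theorem length_columnList (f : ℕ → ℕ) (p : ℕ) : (columnList f p).length = p := by
  simp [columnList]

theorem countGT_columnList (f : ℕ → ℕ) (p v : ℕ) :
    countGT v (columnList f p) = ((Finset.range p).filter (v < f ·)).card := by
  rw [countGT, columnList, List.countP_reverse, List.countP_map, ← Nat.count_eq_card_filter_range]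
  rfl

theorem pairwise_columnList {f : ℕ → ℕ} {p : ℕ} (h : ∀ i k, i < k → k < p → f i < f k) :
    (columnList f p).Pairwise (· > ·) := by
  rw [columnList, List.pairwise_reverse, List.pairwise_map]
  refine List.pairwise_iff_getElem.mpr fun i k hi hk hik => ?_
  simpa using h i k hik (by simpa using hk)

theorem rowLE_columnList {f g : ℕ → ℕ} {p q : ℕ} (hqp : q ≤ p) (h : ∀ i < q, f i ≤ g i) :
    RowLE (columnList f p) (columnList g q) := fun v => by
  rw [countGT_columnList, countGT_columnList, length_columnList, length_columnList]
  have h1 := (Finset.range p).card_filter_add_card_filter_not (v < f ·)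
  have h2 := (Finset.range q).card_filter_add_card_filter_not (v < g ·)
  have h3 : ((Finset.range q).filter (¬ v < g ·)).card ≤
      ((Finset.range p).filter (¬ v < f ·)).card := by
    refine Finset.card_le_card fun i hi => ?_
    simp only [Finset.mem_filter, Finset.mem_range] at hi ⊢
    have := h i hi.1
    omega
  rw [Finset.card_range] at h1 h2
  omega

theorem dominated_columnList {f : ℕ → ℕ} {P : Finset ℕ} (h : ∀ i < P.card, f i ≤ columnEntry P i) :
    Dominated (columnList f P.card) P := fun v => by
  rw [countGT_columnList]
  refine Finset.card_le_card_of_injOn (columnEntry P) (fun i hi => ?_) fun i hi k hk hik => ?_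
  · simp only [Finset.coe_filter, Finset.mem_range, Set.mem_ofPred_eq] at hi ⊢
    exact ⟨columnEntry_mem hi.1, hi.2.trans_le (h i hi.1)⟩
  · simp only [Finset.coe_filter, Finset.mem_range, Set.mem_ofPred_eq] at hi hk
    rcases lt_trichotomy i k with hlt | heq | hlt
    · exact absurd hik (columnEntry_lt hlt hk.1).ne
    · exact heq
    · exact absurd hik (columnEntry_lt hlt hi.1).ne'

/-! ### Gapless pairs from 312-avoidance -/

theorem divider_succ (n : ℕ) (R : Finset ℕ) (h : ℕ) :
    divider n R (h + 1) = (R.sort (· ≤ ·)).getD h n := by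
  simp [divider]

theorem exists_divider_eq {n : ℕ} {R : Finset ℕ} {q : ℕ} (hq : q ∈ R) :
    ∃ h, 1 ≤ h ∧ h ≤ R.card ∧ divider n R h = q := by
  obtain ⟨k, hk, rfl⟩ := List.getElem_of_mem ((Finset.mem_sort (· ≤ ·)).mpr hq)
  refine ⟨k + 1, by omega, by simpa using hk, ?_⟩
  rw [divider_succ, List.getD_eq_getElem _ _ hk]

theorem divider_mono {n : ℕ} {R : Finset ℕ} {h k : ℕ} (h1 : 1 ≤ h) (hhk : h ≤ k)
    (hk : k ≤ R.card) : divider n R h ≤ divider n R k := by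
  obtain ⟨h, rfl⟩ := Nat.exists_eq_add_of_le' h1
  obtain ⟨k, rfl⟩ := Nat.exists_eq_add_of_le' (h1.trans hhk)
  have hk' : k < (R.sort (· ≤ ·)).length := by simpa using hk
  rw [divider_succ, divider_succ, List.getD_eq_getElem _ _ hk',
    List.getD_eq_getElem _ _ (by omega : h < _)]
  exact (Finset.sortedLT_sort R).sortedLE.getElem_le_getElem_of_le (by omega)

theorem mem_firstValues {n : ℕ} (π : Equiv.Perm (Fin n)) {q v : ℕ} :
    v ∈ firstValues π q ↔ ∃ i : Fin n, (i : ℕ) < q ∧ (π i : ℕ) + 1 = v := by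
  simp [firstValues]

/-- A missing `z` sits at a position `c` beyond `p`, giving a 312 pattern at `a`, `b`, `c`. The
pattern must be split by consecutive dividers, so those bounding the carrel of `b` are used. -/
theorem gapless_firstValues {n : ℕ} {R : Finset ℕ} {π : Equiv.Perm (Fin n)}
    (hπ : IsR312Avoiding R π) {p q : ℕ} (hqp : q ≤ p) (hp : p < n → p ∈ R)
    (hq : q < n → q ∈ R) : Gapless (firstValues π p) (firstValues π q) := by
  refine ⟨firstValues_mono π hqp, fun a b z ha hb hb' hbz hza => ?_⟩
  obtain ⟨a, haq, rfl⟩ := (mem_firstValues π).mp ha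
  obtain ⟨b, hbp, rfl⟩ := (mem_firstValues π).mp hb
  have hqb : q ≤ b := by
    by_contra! h
    exact hb' ((mem_firstValues π).mpr ⟨b, h, rfl⟩)
  have hzn : z - 1 < n := by omega
  obtain ⟨c, hc⟩ := π.surjective ⟨z - 1, hzn⟩
  have hcz : (π c : ℕ) = z - 1 := by rw [hc]
  rw [mem_firstValues]
  refine ⟨c, ?_, by omega⟩
  by_contra! hpc
  obtain ⟨k, hk1, hkR, rfl⟩ := exists_divider_eq (n := n) (hp (hpc.trans_lt c.isLt))
  obtain ⟨h, hh1, hhR, rfl⟩ := exists_divider_eq (n := n) (hq (hqb.trans_lt b.isLt))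
  classical
  -- The least such `t` indexes the carrel of `b`.
  have hex : ∃ t, h ≤ t ∧ (b : ℕ) < divider n R (t + 1) ∧ t + 1 ≤ k := by
    refine ⟨k - 1, ?_, ?_, by omega⟩
    · by_contra! hlt
      have := divider_mono (n := n) hk1 (by omega : k ≤ h) hhR
      omega
    · rwa [Nat.sub_add_cancel hk1]
  obtain ⟨hht, hbt, htk⟩ := Nat.find_spec hex
  set t := Nat.find hex with ht
  have htb : divider n R t ≤ b := by
    rcases hht.eq_or_lt with h' | h'
    · rwa [← h']
    · by_contra! hlt
      exact Nat.find_min hex (m := t - 1) (by omega)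
        ⟨by omega, by rwa [Nat.sub_add_cancel (by omega)], by omega⟩
  refine hπ ⟨t, by omega, by omega, a, b, c, ?_, htb, hbt, ?_, ?_, ?_, ?_⟩
  · exact haq.trans_le (divider_mono hh1 hht (by omega))
  · exact (divider_mono (by omega) htk hkR).trans hpc
  all_goals rw [Fin.lt_def]; omega

/-! ### The scanning tableau and the key -/

theorem scanColumns_map_range' (f : ℕ → List ℕ) (s m : ℕ) {j : ℕ} (hj : j < m) :
    (scanColumns ((List.range' s m).map f)).getD j [] =
      scanColumn (f (s + j)) ((List.range' (s + j + 1) (m - j - 1)).map f) := by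
  induction m generalizing s j with
  | zero => omega
  | succ m ih =>
    rw [List.range'_succ, List.map_cons, scanColumns]
    cases j with
    | zero => simp
    | succ j =>
      rw [List.getD_cons_succ, ih (s + 1) (by omega)]
      rw [show s + 1 + j = s + (j + 1) by omega, show m + 1 - (j + 1) - 1 = m - j - 1 by omega]

variable {n : ℕ} {μ : YoungDiagram}

theorem Tableau.scanning_eq (T : Tableau n μ) {i j : ℕ} (hj : j < μ.rowLen 0) :
    T.scanning i j =
      (scanColumn (columnList (T.1 · j) (μ.colLen j))
        ((List.range' (j + 1) (μ.rowLen 0 - j - 1)).map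
          fun k => columnList (T.1 · k) (μ.colLen k))).reverse.getD i 0 := by
  have h := scanColumns_map_range' (fun k => columnList (T.1 · k) (μ.colLen k)) 0 _ hj
  rw [Tableau.scanning, Tableau.columns, List.range_eq_range']
  simp only [Nat.zero_add] at h
  rw [← h]
  rfl

theorem lt_rowLen_zero {i j : ℕ} (h : (i, j) ∈ μ) : j < μ.rowLen 0 :=
  YoungDiagram.mem_iff_lt_rowLen.mp (μ.up_left_mem (Nat.zero_le i) le_rfl h)

theorem Tableau.le_scanning (T : Tableau n μ) {i j : ℕ} (h : (i, j) ∈ μ) :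
    T.1 i j ≤ T.scanning i j := by
  have hi : i < μ.colLen j := YoungDiagram.mem_iff_lt_colLen.mp h
  rw [T.scanning_eq (lt_rowLen_zero h)]
  set cs := (List.range' (j + 1) (μ.rowLen 0 - j - 1)).map
    fun k => columnList (T.1 · k) (μ.colLen k)
  have h2 := (List.forall₂_reverse_iff.mpr
    (forall₂_le_scanColumn (columnList (T.1 · j) (μ.colLen j)) cs))
  have h3 := (List.forall₂_iff_get.mp h2).2 i (by simpa [columnList] using hi)
    (by simpa [columnList, length_scanColumn] using hi)
  rw [List.getD_eq_getElem _ _ (by simpa [columnList, length_scanColumn] using hi)]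
  simpa [columnList] using h3

theorem key_apply (hμ : μ.colLen 0 ≤ n) (π : Equiv.Perm (Fin n)) {i j : ℕ} (h : (i, j) ∈ μ) :
    (key hμ π).1 i j = columnEntry (firstValues π (μ.colLen j)) i :=
  if_pos h

theorem Tableau.le_iff {S T : Tableau n μ} : S ≤ T ↔ ∀ i j, (i, j) ∈ μ → S.1 i j ≤ T.1 i j := by
  refine ⟨fun h i j _ => h i j, fun h i j => ?_⟩
  by_cases hij : (i, j) ∈ μ
  · exact h i j hij
  · exact ((S.1.zeros hij).trans (T.1.zeros hij).symm).le

theorem colLen_mem_columnLengths {j : ℕ} (hj : j < μ.rowLen 0) (h : μ.colLen j < n) :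
    μ.colLen j ∈ columnLengths n μ := by
  simp only [columnLengths, Finset.mem_filter, Finset.mem_image, Finset.mem_range]
  exact ⟨⟨j, hj, rfl⟩, h⟩

theorem scanning_le_key (hμ : μ.colLen 0 ≤ n) {π : Equiv.Perm (Fin n)}
    (hπ : IsR312Avoiding (columnLengths n μ) π) {T : Tableau n μ} (hT : T ≤ key hμ π)
    {i j : ℕ} (hij : (i, j) ∈ μ) : T.scanning i j ≤ (key hμ π).1 i j := by
  have hcard : ∀ k, (firstValues π (μ.colLen k)).card = μ.colLen k := fun k =>
    card_firstValues π ((μ.colLen_anti 0 k (Nat.zero_le k)).trans hμ)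
  have hsort : ∀ k, (columnList (T.1 · k) (μ.colLen k)).Pairwise (· > ·) := fun k =>
    pairwise_columnList fun i l hil hl =>
      T.1.col_strict hil (YoungDiagram.mem_iff_lt_colLen.mpr hl)
  have hdom : ∀ k, Dominated (columnList (T.1 · k) (μ.colLen k))
      (firstValues π (μ.colLen k)) := fun k => by
    have := dominated_columnList (f := (T.1 · k)) (P := firstValues π (μ.colLen k))
      fun i hi => by
        rw [hcard] at hi
        have hik : (i, k) ∈ μ := YoungDiagram.mem_iff_lt_colLen.mpr hi
        rw [← key_apply hμ π hik]
        exact hT i k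
    rwa [hcard] at this
  have hrow : ∀ k l, k < l → RowLE (columnList (T.1 · k) (μ.colLen k))
      (columnList (T.1 · l) (μ.colLen l)) := fun k l hkl =>
    rowLE_columnList (μ.colLen_anti k l hkl.le) fun i hi =>
      T.1.row_weak hkl (YoungDiagram.mem_iff_lt_colLen.mpr hi)
  have hj := lt_rowLen_zero hij
  have hlen : (columnList (T.1 · j) (μ.colLen j)).length =
      (firstValues π (μ.colLen j)).card := by rw [length_columnList, hcard]
  rw [T.scanning_eq hj, key_apply hμ π hij]
  obtain ⟨h1, h2⟩ := scanColumn_dominated (hsort j) (hdom j) hlen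
    (cs := (List.range' (j + 1) (μ.rowLen 0 - j - 1)).map
      fun k => columnList (T.1 · k) (μ.colLen k))
    (fun d hd => by
      obtain ⟨k, hk, rfl⟩ := List.mem_map.mp hd
      rw [List.mem_range'_1] at hk
      exact ⟨hsort k, firstValues π (μ.colLen k), hdom k, by rw [length_columnList, hcard],
        gapless_firstValues hπ (μ.colLen_anti j k (by omega))
          (colLen_mem_columnLengths hj) (colLen_mem_columnLengths (by omega))⟩)
    (by
      rw [← List.map_cons (f := fun k => columnList (T.1 · k) (μ.colLen k)), ← List.range'_succ,
        List.pairwise_map]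
      exact (List.pairwise_lt_range' (s := j)).imp fun h => hrow _ _ h)
  refine reverse_getD_le_columnEntry h1 ((length_scanColumn _ _).trans hlen) h2 ?_
  rw [hcard]
  exact YoungDiagram.mem_iff_lt_colLen.mp hij

theorem demazure_eq_Iic_key (hμ : μ.colLen 0 ≤ n) {π : Equiv.Perm (Fin n)}
    (hπ : IsR312Avoiding (columnLengths n μ) π) : demazure hμ π = Set.Iic (key hμ π) := by
  ext T
  refine ⟨fun h => Tableau.le_iff.mpr fun i j hij => ?_, fun h i j hij => ?_⟩
  · exact (T.le_scanning hij).trans (h i j hij)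
  · exact scanning_le_key hμ hπ h hij

/-! ### Principal ideals are convex polytopes -/

section Polytope

variable {ι : Type*} [Fintype ι]

theorem isConvexPolytope_of_fintype {κ : Type*} [Fintype κ] (A : κ → ι → ℝ) (b : κ → ℝ) :
    IsConvexPolytope {x : ι → ℤ | ∀ k, ∑ i, A k i * (x i : ℝ) ≤ b k} := by
  let e := Fintype.equivFin κ
  refine ⟨Fintype.card κ, fun k => A (e.symm k), fun k => b (e.symm k), ?_⟩
  ext x
  exact e.symm.surjective.forall

theorem IsConvexPolytope.iInter {κ : Type*} [Fintype κ] {D : κ → Set (ι → ℤ)}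
    (h : ∀ k, IsConvexPolytope (D k)) : IsConvexPolytope (⋂ k, D k) := by
  choose m A b hD using h
  convert isConvexPolytope_of_fintype (fun k : Σ k, Fin (m k) => A k.1 k.2)
    (fun k => b k.1 k.2) using 1
  ext x
  simp only [Set.mem_iInter, Set.mem_ofPred_eq, Sigma.forall]
  refine forall_congr' fun k => ?_
  rw [hD k]
  rfl

theorem isConvexPolytope_univ : IsConvexPolytope (Set.univ : Set (ι → ℤ)) :=
  ⟨0, Fin.elim0, Fin.elim0, by ext; simp⟩

theorem IsConvexPolytope.inter {C D : Set (ι → ℤ)} (hC : IsConvexPolytope C)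
    (hD : IsConvexPolytope D) : IsConvexPolytope (C ∩ D) := by
  rw [Set.inter_eq_iInter]
  exact .iInter fun k => by cases k <;> assumption

/-- A false condition imposes nothing, so inequalities may be indexed by all pairs of boxes. -/
theorem isConvexPolytope_imp {p : Prop} {D : Set (ι → ℤ)} (hD : IsConvexPolytope D) :
    IsConvexPolytope {x | p → x ∈ D} := by
  by_cases h : p
  · simpa [h] using hD
  · simpa [h] using isConvexPolytope_univ

open Classical in
theorem isConvexPolytope_add_le (a b : ι) (t : ℤ) :
    IsConvexPolytope {x : ι → ℤ | x a + t ≤ x b} := by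
  convert isConvexPolytope_of_fintype
    (fun (_ : Unit) i => (if i = a then 1 else 0) - (if i = b then 1 else 0)) (fun _ => -(t : ℝ))
    using 1
  ext x
  simp only [Set.mem_ofPred_eq, sub_mul, Finset.sum_sub_distrib, ite_mul, one_mul, zero_mul,
    Finset.sum_ite_eq', Finset.mem_univ, if_true, forall_const]
  rw [← Int.cast_le (R := ℝ)]
  push_cast
  constructor <;> intro h <;> linarith

open Classical in
theorem isConvexPolytope_le (a : ι) (t : ℤ) : IsConvexPolytope {x : ι → ℤ | x a ≤ t} := by
  convert isConvexPolytope_of_fintype (fun (_ : Unit) i => if i = a then 1 else 0)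
    (fun _ => (t : ℝ)) using 1
  ext x
  simp [ite_mul]

open Classical in
theorem isConvexPolytope_ge (a : ι) (t : ℤ) : IsConvexPolytope {x : ι → ℤ | t ≤ x a} := by
  convert isConvexPolytope_of_fintype (fun (_ : Unit) i => if i = a then -1 else 0)
    (fun _ => -(t : ℝ)) using 1
  ext x
  simp [ite_mul]

end Polytope

/-- Strictness down columns becomes a gap of 1 by integrality, and the bound by `n` follows from the
bound by `Y`. -/
theorem toPoint_image_Iic (Y : Tableau n μ) :
    Tableau.toPoint '' Set.Iic Y =
      (⋂ a : μ.cells, {x : μ.cells → ℤ | 1 ≤ x a}) ∩ ((⋂ a : μ.cells, {x | x a ≤ Y.toPoint a}) ∩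
      ((⋂ a : μ.cells, ⋂ b : μ.cells,
        {x | a.1.1 = b.1.1 ∧ a.1.2 < b.1.2 → x ∈ {x : μ.cells → ℤ | x a + 0 ≤ x b}}) ∩
      (⋂ a : μ.cells, ⋂ b : μ.cells,
        {x | a.1.2 = b.1.2 ∧ a.1.1 < b.1.1 → x ∈ {x : μ.cells → ℤ | x a + 1 ≤ x b}}))) := by
  ext x
  simp only [Set.mem_image, Set.mem_Iic, Set.mem_inter_iff, Set.mem_iInter, Set.mem_ofPred_eq]
  constructor
  · rintro ⟨T, hT, rfl⟩
    refine ⟨fun a => ?_, fun a => ?_, ?_, ?_⟩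
    · exact Int.ofNat_le.mpr (T.2 _ _ a.2).1
    · exact Int.ofNat_le.mpr (hT a.1.1 a.1.2)
    · rintro ⟨⟨i, j⟩, ha⟩ ⟨⟨i', k⟩, hb⟩ ⟨rfl, hjk⟩
      simpa [Tableau.toPoint] using T.1.row_weak hjk hb
    · rintro ⟨⟨i, j⟩, ha⟩ ⟨⟨k, j'⟩, hb⟩ ⟨rfl, hik⟩
      have : T.1 i j < T.1 k j := T.1.col_strict hik hb
      change (T.1 i j : ℤ) + 1 ≤ T.1 k j
      omega
  · rintro ⟨hpos, hle, hrow, hcol⟩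
    -- Truncation by `toNat` loses nothing, since `hpos` makes every coordinate positive.
    let f : ℕ → ℕ → ℕ := fun i j => if h : (i, j) ∈ μ then (x ⟨(i, j), h⟩).toNat else 0
    have hf : ∀ {i j} (h : (i, j) ∈ μ), (f i j : ℤ) = x ⟨(i, j), h⟩ := fun {i j} h => by
      have := hpos ⟨(i, j), h⟩
      simp only [f, h, dif_pos]
      omega
    have hfY : ∀ {i j}, (i, j) ∈ μ → f i j ≤ Y.1 i j := fun {i j} h => by
      have h1 := hle ⟨(i, j), h⟩
      rw [← hf h] at h1
      exact Int.ofNat_le.mp h1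
    refine ⟨⟨⟨f, fun {i j k} hjk hc => ?_, fun {i k j} hik hc => ?_, fun {i j} hc => dif_neg hc⟩,
      fun i j hc => ?_⟩, ?_, ?_⟩
    · have hc' : (i, j) ∈ μ := μ.up_left_mem le_rfl hjk.le hc
      have := hrow ⟨(i, j), hc'⟩ ⟨(i, k), hc⟩ ⟨rfl, hjk⟩
      rw [← hf hc, ← hf hc'] at this
      omega
    · have hc' : (i, j) ∈ μ := μ.up_left_mem hik.le le_rfl hc
      have := hcol ⟨(i, j), hc'⟩ ⟨(k, j), hc⟩ ⟨rfl, hik⟩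
      rw [← hf hc, ← hf hc'] at this
      omega
    · have := hpos ⟨(i, j), hc⟩
      rw [← hf hc] at this
      change 1 ≤ f i j ∧ f i j ≤ n
      exact ⟨by omega, (hfY hc).trans (Y.2 i j hc).2⟩
    · exact Tableau.le_iff.mpr fun i j hij => hfY hij
    · funext a
      exact hf a.2

theorem isConvexPolytope_toPoint_image_Iic (Y : Tableau n μ) :
    IsConvexPolytope (Tableau.toPoint '' Set.Iic Y) := by
  rw [toPoint_image_Iic]
  exact .inter (.iInter fun a => isConvexPolytope_ge a 1)
    (.inter (.iInter fun a => isConvexPolytope_le a _)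
    (.inter (.iInter fun a => .iInter fun b => isConvexPolytope_imp (isConvexPolytope_add_le a b 0))
    (.iInter fun a => .iInter fun b => isConvexPolytope_imp (isConvexPolytope_add_le a b 1))))

end DemazureTableaux

theorem mainTheorem2 (n : ℕ) (μ : YoungDiagram) (hμ : μ.colLen 0 ≤ n)
    (π : Equiv.Perm (Fin n))
    (hπ : DemazureTableaux.IsRPermutation (DemazureTableaux.columnLengths n μ) π)
    (havoid : DemazureTableaux.IsR312Avoiding (DemazureTableaux.columnLengths n μ) π) :
    DemazureTableaux.demazure hμ π = Set.Iic (DemazureTableaux.key hμ π) ∧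
      DemazureTableaux.IsConvexPolytope
        (DemazureTableaux.Tableau.toPoint '' DemazureTableaux.demazure hμ π) := by
  have h := DemazureTableaux.demazure_eq_Iic_key hμ havoid
  exact ⟨h, h ▸ DemazureTableaux.isConvexPolytope_toPoint_image_Iic _⟩
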